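/- Let $W=(W(s))_{s\in\mathbb{R}}$ be a two-sided standard Brownian motion, that is, a centered Gaussian process with almost surely continuous sample paths and covariance kernel $\mathcal{C}_{\mathrm{BM}}(s,t)=\min\{|s|,|t|\}\,\mathbf{1}\{\operatorname{sgn}(s)=\operatorname{sgn}(t)\}$. For $\sigma,c,\gamma>0$ let $$\mu_{c,\gamma}(s)=-c|s|\min\{1,|s|\}^{\gamma-1}\quad(\mu_{c,\gamma}(0)=0),\qquad \mathcal{G}(s)=\sigma W(s)+\mu_{c,\gamma}(s),\qquad s\in\mathbb{R}.$$ (a) For every $\gamma\in(0,1/2)$ and every $\sigma>0$ there is a constant $c>0$, depending only on $\gamma$ and $\sigma^2$, such that, for every such $W$ on any probability space, $\mathcal{G}$ has with probability one a unique maximizer $\hat s=\operatorname{argmax}_{s\in\mathbb{R}}\mathcal{G}(s)$ over $\mathbb{R}$, $\hat s$ is a random variable (measurable up to a null set), $P[\hat s=0]>0$, and hence the distribution function $F_{\hat s}(t)=P[\hat s\le t]$ is discontinuous at $t=0$. (b) For all $\gamma,\sigma,c>0$, the following two statements are equivalent: (1) for every $N\in\mathbb{N}$, the restriction of $\mu_{c,\gamma}$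 to $[-N,N]$ belongs to the reproducing kernel Hilbert space of the restriction to $[-N,N]^2$ of the covariance kernel $\sigma^2\mathcal{C}_{\mathrm{BM}}$ of $\mathcal{G}$; (2) $\gamma>1/2$. -/

import Mathlib

open MeasureTheory ProbabilityTheory Set

/-- Covariance kernel of a two-sided standard Brownian motion:
`min {|s|, |t|}` if `sgn s = sgn t`, and `0` otherwise. -/
noncomputable def twoSidedBMKernel (s t : ℝ) : ℝ :=
  if SignType.sign s = SignType.sign t then min |s| |t| else 0

/-- A two-sided standard Brownian motion: a centered Gaussian process on `ℝ` with covariance kernel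
`twoSidedBMKernel` and almost surely continuous sample paths. -/
structure IsTwoSidedBrownianMotion {Ω : Type*} [MeasurableSpace Ω]
    (W : ℝ → Ω → ℝ) (P : Measure Ω) : Prop where
  gaussian : IsGaussianProcess W P
  mean_zero : ∀ s : ℝ, ∫ ω, W s ω ∂P = 0
  covariance_eq : ∀ s t : ℝ, covariance (W s) (W t) P = twoSidedBMKernel s t
  continuous_paths : ∀ᵐ ω ∂P, Continuous (fun s : ℝ => W s ω)

/-- The mean function `μ(s) = -c |s| min {1, |s|} ^ (γ - 1)`; its value at `0` is `0`. -/
noncomputable def powerMean (c γ s : ℝ) : ℝ :=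
  -c * |s| * (min 1 |s|) ^ (γ - 1)

/-- The reproducing kernel Hilbert space of a real kernel `K` on `X`, as a set of functions: the
functions that are elements of a Hilbert space of functions on `X` whose reproducing kernel is `K`.
(That Hilbert space is unique if it exists, and it exists if `K` is positive semidefinite.) -/
def rkhsOfKernel {X : Type} (K : X → X → ℝ) : Set (X → ℝ) :=
  {f | ∃ (H : Type) (_ : NormedAddCommGroup H) (_ : InnerProductSpace ℝ H) (_ : CompleteSpace H)
      (_ : RKHS ℝ H X ℝ),
      (∀ x y : X, RKHS.kernel H x y 1 = K x y) ∧ ∃ h : H, ∀ x : X, h x = f x}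

/-- For every `N`, the restriction of `μ` to `[-N, N]` belongs to the reproducing kernel Hilbert
space of the restriction of the covariance kernel `C` to `[-N, N]`. -/
def RKHSCondition (μ : ℝ → ℝ) (C : ℝ → ℝ → ℝ) : Prop :=
  ∀ N : ℕ, (fun s : Icc (-(N : ℝ)) (N : ℝ) => μ s) ∈
    rkhsOfKernel (fun s t : Icc (-(N : ℝ)) (N : ℝ) => C s t)

/-!
**The maximizer.** For `γ < 1 / 2` the mean `-c |s| ^ γ` falls off at `0` faster than the Brownian
path can rise, and this is quantitative with second moments only. Kolmogorov's maximal inequality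
`IsTwoSidedBrownianMotion.maximal_ineq` bounds `P (sup_{[0, T]} |W| > a)` by `T / a ^ 2`. Summed
over dyadic intervals (`measure_exists_lt_le`), it bounds the probability that `σ |W|` exceeds
`-powerMean c γ` somewhere on a half line by `(σ / c) ^ 2 K`, where `K` depends only on `γ`. The
series near `0` converges exactly because `2 γ < 1`. For large `c` the two half lines together have
probability less than `1`, and otherwise `0` is a maximizer.

A maximizer exists because the same inequality and the Borel-Cantelli lemma give
`W s = o(|s|)` at infinity (`ae_tendsto_atBot`). It is unique because of the following
(`ae_ciSup_ne`): for `0 ≤ q < q'` the increment `X = W q' - W q` is independent of the values of `W`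
up to `q` and of `W - X` from `q'` on, so that the difference between the suprema of the process
over `(-∞, q]` and over `[q', ∞)` is `σ X`, an atomless variable, plus an independent variable, and
almost surely does not vanish. Two maximizers can always be separated in this way, after a time
reversal if neither is positive. Comparing suprema over half lines also shows that the maximizer is
measurable up to a null set, and an atom at `0` is a jump of the distribution function.

**The Hilbert space.** The Brownian kernel is the Gram kernel in `L²` of the indicators of the
intervals between `0` and `t`, and `powerMean c γ` is the integral of its derivative over these
intervals. That derivative is locally square integrable for `γ > 1 / 2`, and
`inner_mem_rkhsOfKernel` gives membership. Conversely, Bessel's inequality for the increments of the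
kernel functions along `2 ^ (-i)` (`exists_sum_sq_le_of_mem_rkhsOfKernel`) would bound a sum of
terms of order `2 ^ (i (1 - 2 γ))`, so `γ > 1 / 2`.
-/

section

open Filter Topology

/-! ### The covariance kernel and the mean function -/

theorem twoSidedBMKernel_of_nonneg {s t : ℝ} (hs : 0 ≤ s) (ht : 0 ≤ t) :
    twoSidedBMKernel s t = min s t := by
  unfold twoSidedBMKernel
  rcases hs.eq_or_lt with rfl | hs' <;> rcases ht.eq_or_lt with rfl | ht'
  · simp
  · simp [sign_pos ht', ht]
  · simp [sign_pos hs', hs]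
  · simp [sign_pos ht', sign_pos hs', abs_of_pos hs', abs_of_pos ht']

theorem twoSidedBMKernel_comm (s t : ℝ) : twoSidedBMKernel s t = twoSidedBMKernel t s := by
  simp [twoSidedBMKernel, eq_comm, min_comm]

theorem twoSidedBMKernel_neg_neg (s t : ℝ) :
    twoSidedBMKernel (-s) (-t) = twoSidedBMKernel s t := by
  simp [twoSidedBMKernel, Left.sign_neg]

theorem twoSidedBMKernel_of_nonpos_of_nonneg {s t : ℝ} (hs : s ≤ 0) (ht : 0 ≤ t) :
    twoSidedBMKernel s t = 0 := by
  unfold twoSidedBMKernel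
  rcases hs.eq_or_lt with rfl | hs' <;> rcases ht.eq_or_lt with rfl | ht'
  · simp
  · simp
  · simp
  · simp [sign_pos ht', sign_neg hs']

theorem powerMean_neg (c γ s : ℝ) : powerMean c γ (-s) = powerMean c γ s := by
  simp [powerMean]

theorem powerMean_of_one_le {c γ s : ℝ} (hs : 1 ≤ |s|) : powerMean c γ s = -c * |s| := by
  simp [powerMean, min_eq_left hs]

theorem powerMean_of_le_one {c γ s : ℝ} (hγ : 0 < γ) (hs : |s| ≤ 1) :
    powerMean c γ s = -c * |s| ^ γ := by
  rw [powerMean, min_eq_right hs, mul_assoc]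
  congr 1
  rcases (abs_nonneg s).eq_or_lt with h | h
  · rw [← h, Real.zero_rpow hγ.ne', zero_mul]
  · rw [Real.rpow_sub_one h.ne']
    field_simp

theorem continuous_powerMean (c : ℝ) {γ : ℝ} (hγ : 0 < γ) : Continuous (powerMean c γ) := by
  have h : powerMean c γ = fun s => -c * ((min 1 |s|) ^ γ + |s| - min 1 |s|) := by
    ext s
    rcases le_total 1 |s| with hs | hs
    · simp [powerMean_of_one_le hs, min_eq_left hs]
    · simp [powerMean_of_le_one hγ hs, min_eq_right hs]
  rw [h]
  have : Continuous fun s : ℝ => (min 1 |s|) ^ γ :=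
    (continuous_const.min continuous_abs).rpow_const fun _ => Or.inr hγ.le
  fun_prop

/-! ### Independence and second moments of increments -/

/-- The residual of a Gaussian process after regression on one of its increments is independent of
that increment; `b` gives the regression coefficients along an index family `f`. -/
theorem ProbabilityTheory.IsGaussianProcess.indepFun_residual {Ω T S : Type*}
    [MeasurableSpace Ω] {P : Measure Ω} {Z : T → Ω → ℝ} (hZ : IsGaussianProcess Z P) (s t : T)
    (f : S → T) (b : S → ℝ)
    (hb : ∀ i, cov[Z t - Z s, Z (f i); P] = b i * Var[Z t - Z s; P]) :
    IndepFun (fun ω => Z t ω - Z s ω)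
      (fun ω i => Z (f i) ω - b i * (Z t ω - Z s ω)) P := by
  classical
  have hP := hZ.isProbabilityMeasure
  have hm := fun i => hZ.aemeasurable i
  have h2 : ∀ i, MemLp (Z i) 2 P := fun i => (hZ.hasGaussianLaw_eval i).memLp_two
  have hX2 : MemLp (Z t - Z s) 2 P := (h2 t).sub (h2 s)
  have key := IsGaussianProcess.indepFun_of_covariance_eq_zero (P := P)
    (X := fun (_ : Unit) ω => Z t ω - Z s ω)
    (Y := fun i ω => Z (f i) ω - b i * (Z t ω - Z s ω)) ?_ ?_ ?_ ?_
  · exact key.comp (measurable_pi_apply ()) measurable_id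
  · refine hZ.of_isGaussianProcess fun i => ?_
    rcases i with u | i
    · refine ⟨{s, t}, ContinuousLinearMap.proj ⟨t, by simp⟩ - ContinuousLinearMap.proj ⟨s, by simp⟩,
        fun ω => ?_⟩
      simp
    · refine ⟨{s, t, f i}, ContinuousLinearMap.proj ⟨f i, by simp⟩ -
        b i • (ContinuousLinearMap.proj ⟨t, by simp⟩ - ContinuousLinearMap.proj ⟨s, by simp⟩),
        fun ω => ?_⟩
      simp
  · exact fun _ => (hm t).sub (hm s)
  · exact fun i => (hm (f i)).sub (((hm t).sub (hm s)).const_mul _)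
  · intro _ i
    change cov[Z t - Z s, Z (f i) - b i • (Z t - Z s); P] = 0
    rw [covariance_sub_right hX2 (h2 _) (hX2.const_smul _), covariance_smul_right, hb,
      covariance_self hX2.1.aemeasurable, sub_self]

namespace IsTwoSidedBrownianMotion

variable {Ω : Type*} [MeasurableSpace Ω] {P : Measure Ω} {W : ℝ → Ω → ℝ}

/-- Time reversal of a two-sided Brownian motion. -/
theorem reflect (hW : IsTwoSidedBrownianMotion W P) :
    IsTwoSidedBrownianMotion (fun s => W (-s)) P where
  gaussian := hW.gaussian.comp_right fun s => -s
  mean_zero s := hW.mean_zero (-s)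
  covariance_eq s t := by rw [hW.covariance_eq, twoSidedBMKernel_neg_neg]
  continuous_paths := hW.continuous_paths.mono fun ω h => h.comp continuous_neg

theorem memLp_two (hW : IsTwoSidedBrownianMotion W P) (s : ℝ) : MemLp (W s) 2 P :=
  (hW.gaussian.hasGaussianLaw_eval s).memLp_two

theorem covariance_increment (hW : IsTwoSidedBrownianMotion W P) (q q' r : ℝ) :
    cov[W q' - W q, W r; P] = twoSidedBMKernel q' r - twoSidedBMKernel q r := by
  have := hW.gaussian.isProbabilityMeasure
  rw [covariance_sub_left (hW.memLp_two _) (hW.memLp_two _) (hW.memLp_two _),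
    hW.covariance_eq, hW.covariance_eq]

theorem variance_increment (hW : IsTwoSidedBrownianMotion W P) {q q' : ℝ} (hq : 0 ≤ q)
    (hqq : q ≤ q') : Var[W q' - W q; P] = q' - q := by
  have := hW.gaussian.isProbabilityMeasure
  have hq' := hq.trans hqq
  rw [← covariance_self ((hW.memLp_two _).sub (hW.memLp_two _)).1.aemeasurable,
    covariance_sub_right ((hW.memLp_two _).sub (hW.memLp_two _)) (hW.memLp_two _)
      (hW.memLp_two _), hW.covariance_increment, hW.covariance_increment]
  simp only [twoSidedBMKernel_of_nonneg, hq, hq']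
  simp [hqq]

/-- An increment over `[q, q']` is uncorrelated with the values up to time `q`. -/
theorem covariance_increment_of_le (hW : IsTwoSidedBrownianMotion W P) {q q' r : ℝ} (hq : 0 ≤ q)
    (hqq : q ≤ q') (hr : r ≤ q) : cov[W q' - W q, W r; P] = 0 := by
  rw [hW.covariance_increment]
  have hq' := hq.trans hqq
  rcases le_total 0 r with h | h
  · rw [twoSidedBMKernel_of_nonneg hq' h, twoSidedBMKernel_of_nonneg hq h, min_eq_right hr,
      min_eq_right (hr.trans hqq), sub_self]
  · rw [← twoSidedBMKernel_neg_neg q', ← twoSidedBMKernel_neg_neg q,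
      twoSidedBMKernel_of_nonpos_of_nonneg (by linarith) (by linarith),
      twoSidedBMKernel_of_nonpos_of_nonneg (by linarith) (by linarith), sub_self]

/-- The regression coefficient of a value after time `q'` on an increment over `[q, q']`
is `1`. -/
theorem covariance_increment_of_ge (hW : IsTwoSidedBrownianMotion W P) {q q' r : ℝ} (hq : 0 ≤ q)
    (hqq : q ≤ q') (hr : q' ≤ r) : cov[W q' - W q, W r; P] = q' - q := by
  rw [hW.covariance_increment, twoSidedBMKernel_of_nonneg (hq.trans hqq) (by linarith),
    twoSidedBMKernel_of_nonneg hq (by linarith), min_eq_left hr, min_eq_left (by linarith)]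

theorem integral_sq (hW : IsTwoSidedBrownianMotion W P) {T : ℝ} (hT : 0 ≤ T) :
    ∫ ω, W T ω ^ 2 ∂P = T := by
  have := hW.gaussian.isProbabilityMeasure
  have h := hW.covariance_eq T T
  rw [covariance_eq_sub (hW.memLp_two T) (hW.memLp_two T), hW.mean_zero,
    twoSidedBMKernel_of_nonneg hT hT, min_self] at h
  simpa [pow_two] using h

theorem ae_eq_zero (hW : IsTwoSidedBrownianMotion W P) : ∀ᵐ ω ∂P, W 0 ω = 0 := by
  have h := hW.integral_sq le_rfl
  rw [integral_eq_zero_iff_of_nonneg (fun ω => sq_nonneg _) (hW.memLp_two 0).integrable_sq] at h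
  filter_upwards [h] with ω hω
  simpa using hω

/-! ### The maximal inequality -/

/-- The value of `W` at `k` on the event that `k` is the first time in `F` at which the modulus
exceeds `a`, and `0` elsewhere. -/
noncomputable def firstExceedance (W : ℝ → Ω → ℝ) (F : Finset ℝ) (a k : ℝ) : Ω → ℝ :=
  {ω | a < |W k ω| ∧ ∀ j ∈ F, j < k → |W j ω| ≤ a}.indicator (W k)

theorem memLp_firstExceedance (hW : IsTwoSidedBrownianMotion W P) (F : Finset ℝ) (a k : ℝ) :
    MemLp (firstExceedance W F a k) 2 P := by
  have hm : ∀ j, AEMeasurable (fun ω => |W j ω|) P := fun j => (hW.gaussian.aemeasurable j).abs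
  have hD : NullMeasurableSet {ω | a < |W k ω| ∧ ∀ j ∈ F, j < k → |W j ω| ≤ a} P := by
    have : {ω | a < |W k ω| ∧ ∀ j ∈ F, j < k → |W j ω| ≤ a} =
        {ω | a < |W k ω|} ∩ ⋂ j ∈ F, {ω | j < k → |W j ω| ≤ a} := by
      ext ω; simp
    rw [this]
    refine (nullMeasurableSet_lt aemeasurable_const (hm k)).inter
      (NullMeasurableSet.biInter F.countable_toSet fun j _ => ?_)
    by_cases hj : j < k
    · simpa only [hj, true_imp_iff] using nullMeasurableSet_le (hm j) aemeasurable_const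
    · simp [hj]
  refine (hW.memLp_two k).of_le ((hW.memLp_two k).1.indicator₀ hD) (ae_of_all _ fun ω => ?_)
  exact norm_indicator_le_norm_self _ _

/-- The increment after `k` is centered and independent of `firstExceedance W F a k`. -/
theorem integral_increment_mul_firstExceedance (hW : IsTwoSidedBrownianMotion W P) {T k : ℝ}
    (hk : 0 ≤ k) (hkT : k ≤ T) (F : Finset ℝ) (a : ℝ) :
    ∫ ω, (W T ω - W k ω) * firstExceedance W F a k ω ∂P = 0 := by
  classical
  have := hW.gaussian.isProbabilityMeasure
  let S := {j // j ∈ insert k F ∧ j ≤ k}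
  have : Finite S := ((insert k F).finite_toSet.subset fun j hj => hj.1).to_subtype
  let k₀ : S := ⟨k, by simp⟩
  let D : Set (S → ℝ) := {w | a < |w k₀| ∧ ∀ j : S, j.1 ∈ F → j.1 < k → |w j| ≤ a}
  have hD : MeasurableSet D := by
    have : D = {w | a < |w k₀|} ∩ ⋂ j : S, {w : S → ℝ | j.1 ∈ F → j.1 < k → |w j| ≤ a} := by
      ext w; simp [D]
    rw [this]
    refine (measurableSet_lt measurable_const (by fun_prop)).inter
      (MeasurableSet.iInter fun j => ?_)
    by_cases hj : j.1 ∈ F ∧ j.1 < k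
    · simpa only [hj.1, hj.2, true_imp_iff] using
        measurableSet_le (by fun_prop) measurable_const
    · have : {w : S → ℝ | j.1 ∈ F → j.1 < k → |w j| ≤ a} = univ :=
        eq_univ_of_forall fun w h1 h2 => (hj ⟨h1, h2⟩).elim
      rw [this]; exact MeasurableSet.univ
  have hind := (hW.gaussian.indepFun_residual k T (fun j : S => j.1) (fun _ => 0) fun j => by
    rw [hW.covariance_increment_of_le hk hkT j.2.2, zero_mul]).comp measurable_id
      ((measurable_pi_apply k₀).indicator hD)
  have heq : (D.indicator fun w => w k₀) ∘
      (fun ω (j : S) => W j.1 ω - 0 * (W T ω - W k ω)) = firstExceedance W F a k := by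
    ext ω
    simp only [Function.comp, firstExceedance, zero_mul, sub_zero]
    refine indicator_eq_indicator ?_ rfl
    simp only [D, S, mem_ofPred_eq, Subtype.forall, Finset.mem_insert]
    exact and_congr Iff.rfl ⟨fun h j hj hjk => h j ⟨Or.inr hj, hjk.le⟩ hj hjk,
      fun h j _ hj hjk => h j hj hjk⟩
  rw [heq] at hind
  have h := hind.integral_mul_eq_mul_integral
    ((hW.memLp_two T).sub (hW.memLp_two k)).1 (hW.memLp_firstExceedance F a k).1
  have h0 : ∫ ω, W T ω - W k ω ∂P = 0 := by
    rw [integral_sub ((hW.memLp_two T).integrable one_le_two)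
      ((hW.memLp_two k).integrable one_le_two), hW.mean_zero, hW.mean_zero, sub_zero]
  simpa [h0] using h

/-- Kolmogorov's maximal inequality on a finite set of times: on the event that the modulus exceeds
`a`, the last value is decomposed at the first exceedance time, and the cross term vanishes in the
mean. -/
theorem maximal_ineq_finset (hW : IsTwoSidedBrownianMotion W P) {T a : ℝ} (ha : 0 < a)
    (hT : 0 ≤ T) (F : Finset ℝ) (hF : ∀ k ∈ F, 0 ≤ k ∧ k ≤ T) :
    P {ω | ∃ k ∈ F, a < |W k ω|} ≤ ENNReal.ofReal (T / a ^ 2) := by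
  classical
  have := hW.gaussian.isProbabilityMeasure
  let φ := firstExceedance W F a
  let f : Ω → ℝ := fun ω => W T ω ^ 2 - 2 * ∑ k ∈ F, (W T ω - W k ω) * φ k ω
  have hint : ∀ k ∈ F, Integrable (fun ω => (W T ω - W k ω) * φ k ω) P := fun k _ =>
    ((hW.memLp_two T).sub (hW.memLp_two k)).integrable_mul (hW.memLp_firstExceedance F a k)
  have hfint : Integrable f P :=
    (hW.memLp_two T).integrable_sq.sub ((integrable_finsetSum F hint).const_mul 2)
  have hfI : ∫ ω, f ω ∂P = T := by
    rw [integral_sub (hW.memLp_two T).integrable_sq ((integrable_finsetSum F hint).const_mul 2),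
      integral_const_mul, integral_finsetSum F hint, hW.integral_sq hT,
      Finset.sum_eq_zero fun k hk =>
        hW.integral_increment_mul_firstExceedance (hF k hk).1 (hF k hk).2 F a]
    simp
  have hfa : ∀ ω, (∃ k ∈ F, a < |W k ω|) → a ^ 2 ≤ f ω := by
    rintro ω ⟨k, hk, hak⟩
    have hne : (F.filter fun j => a < |W j ω|).Nonempty := ⟨k, by simp [hk, hak]⟩
    obtain ⟨m, hm, hmin⟩ := Finset.exists_minimal hne
    simp only [Finset.mem_filter] at hm
    have hmin' : ∀ j ∈ F, j < m → |W j ω| ≤ a := fun j hj hjm => by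
      by_contra! h
      exact absurd (hmin (by simp [hj, h]) hjm.le) (not_le.2 hjm)
    have hsum : ∑ k ∈ F, (W T ω - W k ω) * φ k ω = (W T ω - W m ω) * W m ω := by
      rw [Finset.sum_eq_single_of_mem m hm.1]
      · simp only [φ, firstExceedance]
        rw [indicator_of_mem]
        exact ⟨hm.2, hmin'⟩
      · intro j hj hjm
        simp only [φ, firstExceedance]
        rw [indicator_of_notMem, mul_zero]
        rintro ⟨h1, h2⟩
        rcases lt_or_gt_of_ne hjm with h | h
        · exact absurd (hmin' j hj h) (not_le.2 h1)
        · exact absurd (h2 m hm.1 h) (not_le.2 hm.2)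
    have h1 : a ^ 2 ≤ W m ω ^ 2 := by
      rw [← sq_abs (W m ω)]; exact pow_le_pow_left₀ ha.le hm.2.le 2
    simp only [f, hsum]
    nlinarith [sq_nonneg (W T ω - W m ω)]
  have hf0 : ∀ ω, 0 ≤ f ω := fun ω => by
    by_cases h : ∃ k ∈ F, a < |W k ω|
    · exact (sq_nonneg a).trans (hfa ω h)
    · push Not at h
      have : ∑ k ∈ F, (W T ω - W k ω) * φ k ω = 0 := Finset.sum_eq_zero fun k hk => by
        simp only [φ, firstExceedance]
        rw [indicator_of_notMem, mul_zero]
        exact fun h' => absurd (h k hk) (not_le.2 h'.1)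
      simp only [f, this]
      nlinarith [sq_nonneg (W T ω)]
  have hM := mul_meas_ge_le_integral_of_nonneg (ae_of_all _ hf0) hfint (a ^ 2)
  rw [hfI] at hM
  calc P {ω | ∃ k ∈ F, a < |W k ω|} ≤ P {ω | a ^ 2 ≤ f ω} := measure_mono hfa
    _ = ENNReal.ofReal (P.real {ω | a ^ 2 ≤ f ω}) := by simp
    _ ≤ ENNReal.ofReal (T / a ^ 2) := by
      refine ENNReal.ofReal_le_ofReal ?_
      rw [le_div_iff₀ (by positivity)]
      linarith

/-- Kolmogorov's maximal inequality on a compact interval: by continuity it is enough to look at a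
dense sequence of times. -/
theorem maximal_ineq (hW : IsTwoSidedBrownianMotion W P) {T a : ℝ} (ha : 0 < a) (hT : 0 ≤ T) :
    P {ω | ∃ s ∈ Icc 0 T, a < |W s ω|} ≤ ENNReal.ofReal (T / a ^ 2) := by
  classical
  have : Nonempty (Icc 0 T) := ⟨⟨0, by simp [hT]⟩⟩
  let d : ℕ → Icc 0 T := TopologicalSpace.denseSeq (Icc 0 T)
  let F : ℕ → Finset ℝ := fun n => (Finset.range n).image fun i => (d i : ℝ)
  let A : ℕ → Set Ω := fun n => {ω | ∃ k ∈ F n, a < |W k ω|}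
  have hmono : Monotone A := by
    rintro m n hmn ω ⟨k, hk, h⟩
    exact ⟨k, Finset.image_subset_image (Finset.range_mono hmn) hk, h⟩
  calc P {ω | ∃ s ∈ Icc 0 T, a < |W s ω|} ≤ P (⋃ n, A n) := by
        refine measure_mono_ae ?_
        filter_upwards [hW.continuous_paths] with ω hω
        rintro ⟨s, hs, hsa⟩
        have hopen : IsOpen {x : Icc 0 T | a < |W x ω|} :=
          isOpen_lt continuous_const (hω.comp continuous_subtype_val).abs
        obtain ⟨n, hn⟩ := (TopologicalSpace.denseRange_denseSeq (Icc 0 T)).exists_mem_open hopen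
          ⟨⟨s, hs⟩, hsa⟩
        exact mem_iUnion.2 ⟨n + 1, d n, Finset.mem_image_of_mem _ (by simp), hn⟩
    _ = ⨆ n, P (A n) := hmono.measure_iUnion
    _ ≤ ENNReal.ofReal (T / a ^ 2) := iSup_le fun n =>
        hW.maximal_ineq_finset ha hT (F n) fun k hk => by
          obtain ⟨i, -, rfl⟩ := Finset.mem_image.1 hk
          exact (d i).2

end IsTwoSidedBrownianMotion

/-! ### Uniqueness of the maximizer -/

/-- The supremum of a continuous function along a dense sequence is its maximum. -/
theorem ciSup_denseSeq_eq {X : Type*} [TopologicalSpace X] [TopologicalSpace.SeparableSpace X]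
    [Nonempty X] {f : X → ℝ} (hf : Continuous f) {x : X} (hx : ∀ y, f y ≤ f x) :
    ⨆ n, f (TopologicalSpace.denseSeq X n) = f x := by
  refine le_antisymm (ciSup_le fun n => hx _) (le_of_forall_lt fun a ha => ?_)
  obtain ⟨n, hn⟩ := (TopologicalSpace.denseRange_denseSeq X).exists_mem_open
    (isOpen_lt continuous_const hf) ⟨x, ha⟩
  exact hn.trans_le (le_ciSup (f := fun n => f (TopologicalSpace.denseSeq X n))
    ⟨f x, by rintro _ ⟨n, rfl⟩; exact hx _⟩ n)

/-- An atomless random variable almost surely avoids every function of an independent one. -/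
theorem ProbabilityTheory.IndepFun.ae_ne {Ω β : Type*} [MeasurableSpace Ω] [MeasurableSpace β]
    {P : Measure Ω} [IsProbabilityMeasure P] {X : Ω → ℝ} {Y : Ω → β} (h : IndepFun X Y P)
    (hX : AEMeasurable X P) (hY : AEMeasurable Y P) (hatom : ∀ x, P.map X {x} = 0)
    {g : β → ℝ} (hg : Measurable g) : ∀ᵐ ω ∂P, X ω ≠ g (Y ω) := by
  have hS : MeasurableSet {p : β × ℝ | p.2 = g p.1} :=
    measurableSet_eq_fun measurable_snd (hg.comp measurable_fst)
  have h0 : P.map (fun ω => (Y ω, X ω)) {p : β × ℝ | p.2 = g p.1} = 0 := by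
    rw [h.symm.map_prod_eq_prod_map_map hY hX, Measure.measure_prod_null hS]
    exact ae_of_all _ fun y => hatom (g y)
  rw [Measure.map_apply_of_aemeasurable (hY.prodMk hX) hS] at h0
  exact measure_eq_zero_iff_ae_notMem.1 h0

namespace IsTwoSidedBrownianMotion

variable {Ω : Type*} [MeasurableSpace Ω] {P : Measure Ω} {W : ℝ → Ω → ℝ}

theorem map_increment_singleton (hW : IsTwoSidedBrownianMotion W P) {q q' : ℝ} (hq : 0 ≤ q)
    (hqq : q < q') (x : ℝ) : P.map (W q' - W q) {x} = 0 := by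
  rw [hW.gaussian.hasGaussianLaw_sub.map_eq_gaussianReal, hW.variance_increment hq hqq.le]
  have := nullSingletonClass_gaussianReal (μ := P[W q' - W q]) (v := (q' - q).toNNReal)
    (by simpa using hqq)
  exact measure_singleton x

/-- The suprema of `σ W + m` before `q` and after `q'` almost surely differ: the increment over
`[q, q']` contributes only to the second one, additively, and is independent of the rest. -/
theorem ae_ciSup_ne (hW : IsTwoSidedBrownianMotion W P) {σ : ℝ} (hσ : 0 < σ) (m : ℝ → ℝ)
    {q q' : ℝ} (hq : 0 ≤ q) (hqq : q < q') (d : ℕ → Iic q) (d' : ℕ → Ici q') :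
    ∀ᵐ ω ∂P, BddAbove (range fun n => σ * W (d' n) ω + m (d' n)) →
      ⨆ n, (σ * W (d n) ω + m (d n)) ≠ ⨆ n, (σ * W (d' n) ω + m (d' n)) := by
  have := hW.gaussian.isProbabilityMeasure
  let f : ℕ ⊕ ℕ → ℝ := Sum.elim (fun n => (d n : ℝ)) fun n => (d' n : ℝ)
  let b : ℕ ⊕ ℕ → ℝ := Sum.elim (fun _ => 0) fun _ => 1
  have hind := hW.gaussian.indepFun_residual q q' f b fun i => by
    rw [hW.variance_increment hq hqq.le]
    rcases i with n | n
    · simpa [b, f] using hW.covariance_increment_of_le hq hqq.le (d n).2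
    · simpa [b, f] using hW.covariance_increment_of_ge hq hqq.le (d' n).2
  have hm := hW.gaussian.aemeasurable
  have hX : AEMeasurable (fun ω => W q' ω - W q ω) P := (hm q').sub (hm q)
  let g : (ℕ ⊕ ℕ → ℝ) → ℝ := fun y =>
    ((⨆ n, (σ * y (Sum.inl n) + m (d n))) - ⨆ n, (σ * y (Sum.inr n) + m (d' n))) / σ
  have hg : Measurable g := by
    refine Measurable.div_const (Measurable.sub ?_ ?_) σ <;>
      exact Measurable.iSup fun n => by fun_prop
  filter_upwards [hind.ae_ne hX (aemeasurable_pi_lambda _ fun i =>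
    (hm (f i)).sub (hX.const_mul (b i))) (hW.map_increment_singleton hq hqq) hg]
    with ω hω hbdd heq
  refine hω ?_
  set x := W q' ω - W q ω with hx
  have h2 : ⨆ n, (σ * (W (d' n) ω - x) + m (d' n)) =
      (⨆ n, (σ * W (d' n) ω + m (d' n))) - σ * x := by
    rw [sub_eq_add_neg, ciSup_add hbdd]
    congr 1; ext n; ring
  simp only [g, f, b, Sum.elim_inl, Sum.elim_inr, zero_mul, sub_zero, one_mul, h2, heq]
  field_simp
  ring

/-- Almost surely no maximizer lies to the right of both `0` and another maximizer. -/
theorem ae_not_isMaxOn_pair (hW : IsTwoSidedBrownianMotion W P) {σ : ℝ} (hσ : 0 < σ) {m : ℝ → ℝ}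
    (hm : Continuous m) :
    ∀ᵐ ω ∂P, ∀ s₁ s₂ : ℝ, s₁ < s₂ → 0 < s₂ →
      IsMaxOn (fun t => σ * W t ω + m t) univ s₁ →
      ¬ IsMaxOn (fun t => σ * W t ω + m t) univ s₂ := by
  have key : ∀ᵐ ω ∂P, ∀ q q' : ℚ, (0 : ℝ) ≤ q → (q : ℝ) < q' →
      BddAbove (range fun n => σ * W (TopologicalSpace.denseSeq (Ici (q' : ℝ)) n) ω +
        m (TopologicalSpace.denseSeq (Ici (q' : ℝ)) n)) →
      ⨆ n, (σ * W (TopologicalSpace.denseSeq (Iic (q : ℝ)) n) ω +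
        m (TopologicalSpace.denseSeq (Iic (q : ℝ)) n)) ≠
      ⨆ n, (σ * W (TopologicalSpace.denseSeq (Ici (q' : ℝ)) n) ω +
        m (TopologicalSpace.denseSeq (Ici (q' : ℝ)) n)) := by
    refine ae_all_iff.2 fun q => ae_all_iff.2 fun q' => ?_
    by_cases hq : (0 : ℝ) ≤ q
    · by_cases hqq : (q : ℝ) < q'
      · filter_upwards [hW.ae_ciSup_ne hσ m hq hqq (TopologicalSpace.denseSeq _)
          (TopologicalSpace.denseSeq _)] with ω hω _ _ using hω
      · exact ae_of_all _ fun _ _ h => (hqq h).elim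
    · exact ae_of_all _ fun _ h => (hq h).elim
  filter_upwards [key, hW.continuous_paths] with ω hω hcont s₁ s₂ h12 h2 hm1 hm2
  have hG : Continuous fun t => σ * W t ω + m t := (hcont.const_mul σ).add hm
  obtain ⟨q, hq1, hq2⟩ := exists_rat_btwn (max_lt h12 h2)
  obtain ⟨q', hq1', hq2'⟩ := exists_rat_btwn hq2
  have hmax1 : ∀ t, σ * W t ω + m t ≤ σ * W s₁ ω + m s₁ := fun t => hm1 (mem_univ t)
  have hmax2 : ∀ t, σ * W t ω + m t ≤ σ * W s₂ ω + m s₂ := fun t => hm2 (mem_univ t)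
  refine hω q q' ((le_max_right _ _).trans hq1.le) hq1'
    ⟨σ * W s₂ ω + m s₂, by rintro _ ⟨n, rfl⟩; exact hmax2 _⟩ ?_
  have e1 := ciSup_denseSeq_eq (X := Iic (q : ℝ)) (hG.comp continuous_subtype_val)
    (x := ⟨s₁, (le_max_left _ _).trans hq1.le⟩) fun y => hmax1 y
  have e2 := ciSup_denseSeq_eq (X := Ici (q' : ℝ)) (hG.comp continuous_subtype_val)
    (x := ⟨s₂, hq2'.le⟩) fun y => hmax2 y
  exact (e1.trans (le_antisymm (hmax2 s₁) (hmax1 s₂))).trans e2.symm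

theorem ae_isMaxOn_unique (hW : IsTwoSidedBrownianMotion W P) {σ : ℝ} (hσ : 0 < σ) {m : ℝ → ℝ}
    (hm : Continuous m) :
    ∀ᵐ ω ∂P, ∀ s₁ s₂ : ℝ, IsMaxOn (fun t => σ * W t ω + m t) univ s₁ →
      IsMaxOn (fun t => σ * W t ω + m t) univ s₂ → s₁ = s₂ := by
  have hneg : ∀ (ω : Ω) (s : ℝ), IsMaxOn (fun t => σ * W t ω + m t) univ s →
      IsMaxOn (fun t => σ * W (-t) ω + m (-t)) univ (-s) := fun ω s h t _ => by
    simpa using h (mem_univ (-t))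
  filter_upwards [hW.ae_not_isMaxOn_pair hσ hm,
    hW.reflect.ae_not_isMaxOn_pair hσ (hm.comp continuous_neg)] with ω h1 h2
  have key : ∀ s₁ s₂ : ℝ, s₁ < s₂ → IsMaxOn (fun t => σ * W t ω + m t) univ s₁ →
      ¬ IsMaxOn (fun t => σ * W t ω + m t) univ s₂ := fun s₁ s₂ h12 hm1 hm2 => by
    rcases lt_or_ge 0 s₂ with h | h
    · exact h1 s₁ s₂ h12 h hm1 hm2
    · exact h2 (-s₂) (-s₁) (by linarith) (by linarith) (hneg ω _ hm2) (hneg ω _ hm1)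
  intro s₁ s₂ hm1 hm2
  rcases lt_trichotomy s₁ s₂ with h | h | h
  · exact (key _ _ h hm1 hm2).elim
  · exact h
  · exact (key _ _ h hm2 hm1).elim

/-! ### Existence of the maximizer -/

/-- Sublinear growth at `+∞`, from the maximal inequality on `[0, 2 ^ (k + 1)]` and the
Borel-Cantelli lemma. -/
theorem ae_exists_abs_le_mul (hW : IsTwoSidedBrownianMotion W P) {δ : ℝ} (hδ : 0 < δ) :
    ∀ᵐ ω ∂P, ∃ R : ℝ, ∀ s, R ≤ s → |W s ω| ≤ δ * s := by
  let B : ℕ → Set Ω := fun k => {ω | ∃ s ∈ Icc (0 : ℝ) (2 ^ (k + 1)), δ * 2 ^ k < |W s ω|}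
  have hB : ∀ k, P (B k) ≤ ENNReal.ofReal (2 / δ ^ 2 * (1 / 2) ^ k) := fun k => by
    refine (hW.maximal_ineq (by positivity) (by positivity)).trans_eq ?_
    congr 1
    rw [one_div, inv_pow]
    field_simp
    ring
  have hsum : ∑' k, P (B k) ≠ ⊤ := by
    refine ne_top_of_le_ne_top ?_ (ENNReal.tsum_le_tsum hB)
    rw [← ENNReal.ofReal_tsum_of_nonneg (fun k => by positivity)
      (summable_geometric_two.mul_left _)]
    exact ENNReal.ofReal_ne_top
  filter_upwards [ae_eventually_notMem hsum] with ω hω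
  obtain ⟨K, hK⟩ := eventually_atTop.1 hω
  refine ⟨2 ^ K, fun s hs => ?_⟩
  obtain ⟨k, hk1, hk2⟩ := exists_nat_pow_near ((one_le_pow₀ one_le_two).trans hs) one_lt_two
  have hKk : K ≤ k := by
    have := (pow_lt_pow_iff_right₀ (one_lt_two (α := ℝ))).1 (hs.trans_lt hk2)
    omega
  by_contra! h
  exact hK k hKk ⟨s, ⟨(by positivity : (0 : ℝ) ≤ 2 ^ k).trans hk1, hk2.le⟩,
    (mul_le_mul_of_nonneg_left hk1 hδ.le).trans_lt h⟩

theorem ae_tendsto_atBot (hW : IsTwoSidedBrownianMotion W P) {σ c γ : ℝ} (hσ : 0 < σ)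
    (hc : 0 < c) :
    ∀ᵐ ω ∂P, Tendsto (fun t => σ * W t ω + powerMean c γ t) (cocompact ℝ) atBot := by
  have hδ : 0 < c / (2 * σ) := by positivity
  filter_upwards [hW.ae_exists_abs_le_mul hδ, hW.reflect.ae_exists_abs_le_mul hδ]
    with ω ⟨R₁, h₁⟩ ⟨R₂, h₂⟩
  have hlim : Tendsto (fun t : ℝ => -(c / 2) * |t|) (cocompact ℝ) atBot :=
    (tendsto_norm_cocompact_atTop (E := ℝ)).const_mul_atTop_of_neg (by linarith)
  refine tendsto_atBot_mono' _ ?_ hlim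
  filter_upwards [(tendsto_norm_cocompact_atTop (E := ℝ)).eventually_ge_atTop
    (max 1 (max R₁ R₂))] with t ht
  rw [Real.norm_eq_abs, max_le_iff, max_le_iff] at ht
  rw [powerMean_of_one_le ht.1]
  have hWt : |W t ω| ≤ c / (2 * σ) * |t| := by
    rcases le_total 0 t with h | h
    · rw [abs_of_nonneg h] at ht ⊢
      exact h₁ t ht.2.1
    · rw [abs_of_nonpos h] at ht ⊢
      simpa using h₂ (-t) ht.2.2
  have := mul_le_mul_of_nonneg_left ((le_abs_self _).trans hWt) hσ.le
  have e : σ * (c / (2 * σ) * |t|) = c / 2 * |t| := by field_simp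
  rw [e] at this
  linarith

end IsTwoSidedBrownianMotion

/-! ### The probability that the maximizer is `0` -/

/-- Halving `s` divides `s` by `2` but `(s ^ γ) ^ 2` by less than `2`, so that the terms of the
dyadic union bound near `0` form a convergent geometric series. -/
theorem half_lt_half_rpow_sq {γ : ℝ} (h : γ < 1 / 2) :
    (1 / 2 : ℝ) < ((1 / 2 : ℝ) ^ γ) ^ 2 := by
  rw [← Real.rpow_mul_natCast (by norm_num)]
  conv_lhs => rw [← Real.rpow_one (1 / 2 : ℝ)]
  exact Real.rpow_lt_rpow_of_exponent_gt (by norm_num) (by norm_num) (by push_cast; linarith)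

namespace IsTwoSidedBrownianMotion

variable {Ω : Type*} [MeasurableSpace Ω] {P : Measure Ω} {W : ℝ → Ω → ℝ}

/-- Union bound over the dyadic intervals `[2 ^ k, 2 ^ (k + 1)]` and
`[2 ^ (-(k + 1)), 2 ^ (-k)]`, `k ≥ 0`, with the maximal inequality up to the right endpoint of each
of them. The bound depends only on `γ` and `σ / c`. -/
theorem measure_exists_lt_le (hW : IsTwoSidedBrownianMotion W P) {σ c γ p : ℝ} (hσ : 0 < σ)
    (hc : 0 < c) (hγ : 0 < γ) (hp : p = (1 / 2 : ℝ) ^ γ) (hp2 : 1 / 2 < p ^ 2) :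
    P {ω | ∃ s, 0 < s ∧ -powerMean c γ s < σ * |W s ω|} ≤
      ENNReal.ofReal ((σ / c) ^ 2 * (4 + 1 / p ^ 2 * (1 - 1 / (2 * p ^ 2))⁻¹)) := by
  have hp0 : 0 < p := hp ▸ by positivity
  set r : ℝ := 1 / (2 * p ^ 2) with hr
  have hr0 : 0 ≤ r := by positivity
  have hr1 : r < 1 := by rw [hr, div_lt_one (by positivity)]; linarith
  let B : ℕ → Set Ω := fun k => {ω | ∃ s ∈ Icc (0 : ℝ) (2 ^ (k + 1)), c / σ * 2 ^ k < |W s ω|}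
  let C : ℕ → Set Ω := fun k =>
    {ω | ∃ s ∈ Icc (0 : ℝ) ((1 / 2) ^ k), c / σ * p ^ (k + 1) < |W s ω|}
  have hB : ∀ k, P (B k) ≤ ENNReal.ofReal ((σ / c) ^ 2 * 2 * (1 / 2) ^ k) := fun k => by
    refine (hW.maximal_ineq (by positivity) (by positivity)).trans_eq ?_
    congr 1
    rw [one_div, inv_pow]
    field_simp
    ring
  have hC : ∀ k, P (C k) ≤ ENNReal.ofReal ((σ / c) ^ 2 * (1 / p ^ 2) * r ^ k) := fun k => by
    refine (hW.maximal_ineq (by positivity) (by positivity)).trans_eq ?_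
    congr 1
    rw [hr, one_div (2 * p ^ 2), inv_pow, mul_pow 2, one_div (2 : ℝ), inv_pow]
    field_simp
    ring
  have hBs : ∑' k, P (B k) ≤ ENNReal.ofReal ((σ / c) ^ 2 * 4) := by
    refine (ENNReal.tsum_le_tsum hB).trans_eq ?_
    rw [← ENNReal.ofReal_tsum_of_nonneg (fun k => by positivity)
      (summable_geometric_two.mul_left _), tsum_mul_left, tsum_geometric_two]
    congr 1; ring
  have hCs : ∑' k, P (C k) ≤ ENNReal.ofReal ((σ / c) ^ 2 * (1 / p ^ 2 * (1 - r)⁻¹)) := by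
    refine (ENNReal.tsum_le_tsum hC).trans_eq ?_
    rw [← ENNReal.ofReal_tsum_of_nonneg (fun k => by positivity)
      ((summable_geometric_of_lt_one hr0 hr1).mul_left _), tsum_mul_left,
      tsum_geometric_of_lt_one hr0 hr1]
    congr 1; ring
  have hsub : {ω | ∃ s, 0 < s ∧ -powerMean c γ s < σ * |W s ω|} ⊆ (⋃ k, B k) ∪ ⋃ k, C k := by
    rintro ω ⟨s, hs, h⟩
    rcases le_total 1 s with hs1 | hs1
    · left
      rw [powerMean_of_one_le (by rwa [abs_of_pos hs]), abs_of_pos hs] at h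
      obtain ⟨k, hk1, hk2⟩ := exists_nat_pow_near hs1 one_lt_two
      refine mem_iUnion.2 ⟨k, s, ⟨hs.le, hk2.le⟩, ?_⟩
      rw [div_mul_eq_mul_div, div_lt_iff₀ hσ]
      have := mul_le_mul_of_nonneg_left hk1 hc.le
      linarith
    · right
      rw [powerMean_of_le_one hγ (by rwa [abs_of_pos hs]), abs_of_pos hs] at h
      obtain ⟨k, hk1, hk2⟩ := exists_nat_pow_near_of_lt_one hs hs1 (y := (1 / 2 : ℝ))
        (by norm_num) (by norm_num)
      refine mem_iUnion.2 ⟨k, s, ⟨hs.le, hk2⟩, ?_⟩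
      have hpk : p ^ (k + 1) ≤ s ^ γ := by
        rw [hp, ← Real.rpow_mul_natCast (by norm_num), mul_comm,
          Real.rpow_natCast_mul (by norm_num)]
        exact Real.rpow_le_rpow (by positivity) hk1.le hγ.le
      rw [div_mul_eq_mul_div, div_lt_iff₀ hσ]
      have := mul_le_mul_of_nonneg_left hpk hc.le
      linarith
  calc _ ≤ P ((⋃ k, B k) ∪ ⋃ k, C k) := measure_mono hsub
    _ ≤ ∑' k, P (B k) + ∑' k, P (C k) :=
      (measure_union_le _ _).trans (add_le_add (measure_iUnion_le _) (measure_iUnion_le _))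
    _ ≤ _ := (add_le_add hBs hCs).trans_eq (by
      have : 0 ≤ (1 - r)⁻¹ := inv_nonneg.2 (by linarith)
      rw [← ENNReal.ofReal_add (by positivity) (by positivity), mul_add])

/-- If the bounds on both half lines add up to less than `1`, then with positive probability `0` is
a maximizer. -/
theorem measure_isMaxOn_zero_pos (hW : IsTwoSidedBrownianMotion W P) {σ c γ p : ℝ} (hσ : 0 < σ)
    (hc : 0 < c) (hγ : 0 < γ) (hp : p = (1 / 2 : ℝ) ^ γ) (hp2 : 1 / 2 < p ^ 2)
    (hsmall : (σ / c) ^ 2 * (4 + 1 / p ^ 2 * (1 - 1 / (2 * p ^ 2))⁻¹) < 1 / 2) :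
    0 < P {ω | IsMaxOn (fun t => σ * W t ω + powerMean c γ t) univ 0} := by
  have hprob := hW.gaussian.isProbabilityMeasure
  set κ := (σ / c) ^ 2 * (4 + 1 / p ^ 2 * (1 - 1 / (2 * p ^ 2))⁻¹)
  set M := {ω | IsMaxOn (fun t => σ * W t ω + powerMean c γ t) univ 0}
  set E := {ω | ∃ s, 0 < s ∧ -powerMean c γ s < σ * |W s ω|}
  set E' := {ω | ∃ s, 0 < s ∧ -powerMean c γ s < σ * |W (-s) ω|}
  set Z := {ω | W 0 ω ≠ 0}
  have hE : P E ≤ ENNReal.ofReal κ := hW.measure_exists_lt_le hσ hc hγ hp hp2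
  have hE' : P E' ≤ ENNReal.ofReal κ := hW.reflect.measure_exists_lt_le hσ hc hγ hp hp2
  have hZ : P Z = 0 := hW.ae_eq_zero
  have hcov : (univ : Set Ω) ⊆ ((M ∪ E) ∪ E') ∪ Z := fun ω _ => by
    by_contra h
    simp only [mem_union, not_or] at h
    obtain ⟨⟨⟨hM, h1⟩, h2⟩, h3⟩ := h
    have h3 : W 0 ω = 0 := not_not.1 h3
    refine hM fun t _ => ?_
    have h0 : powerMean c γ 0 = 0 := by simp [powerMean]
    simp only [mem_ofPred_eq, h3, h0, mul_zero, add_zero]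
    have hle := mul_le_mul_of_nonneg_left (le_abs_self (W t ω)) hσ.le
    rcases lt_trichotomy t 0 with ht | rfl | ht
    · have : ¬ -powerMean c γ (-t) < σ * |W (- -t) ω| := fun h => h2 ⟨-t, by linarith, h⟩
      rw [powerMean_neg, neg_neg] at this
      linarith
    · simp [h3, h0]
    · have : ¬ -powerMean c γ t < σ * |W t ω| := fun h => h1 ⟨t, ht, h⟩
      linarith
  by_contra hM
  have hM : P M = 0 := by simpa using hM
  have h1 : (1 : ENNReal) ≤ ENNReal.ofReal κ + ENNReal.ofReal κ :=
    calc (1 : ENNReal) = P univ := measure_univ.symm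
      _ ≤ ((P M + P E) + P E') + P Z := (measure_mono hcov).trans <|
        (measure_union_le _ _).trans <| add_le_add_left ((measure_union_le _ _).trans <|
          add_le_add_left (measure_union_le _ _) _) _
      _ ≤ _ := by
        rw [hM, hZ, zero_add, add_zero]
        exact add_le_add hE hE'
  have hlt : ENNReal.ofReal κ < ENNReal.ofReal (1 / 2) :=
    (ENNReal.ofReal_lt_ofReal_iff (by norm_num)).2 hsmall
  have h2 := ENNReal.add_lt_add hlt hlt
  rw [← ENNReal.ofReal_add (p := 1 / 2) (by norm_num) (by norm_num), add_halves,
    ENNReal.ofReal_one] at h2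
  exact absurd h1 (not_le.2 h2)

/-! ### Measurability of the maximizer and its distribution function -/

/-- The maximizer is measurable up to a null set: almost surely it lies in `(-∞, t)` exactly if the
supremum over `(-∞, t]` exceeds the supremum over `[t, ∞)`, and both suprema can be taken over
countable sets. -/
theorem aemeasurable_argmax (hW : IsTwoSidedBrownianMotion W P) {σ c γ : ℝ} (hσ : 0 < σ)
    (hc : 0 < c) (hγ : 0 < γ) {s_hat : Ω → ℝ}
    (hs : ∀ᵐ ω ∂P, IsMaxOn (fun t => σ * W t ω + powerMean c γ t) univ (s_hat ω)) :
    AEMeasurable s_hat P := by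
  refine NullMeasurable.aemeasurable (measurable_of_Iio (δ := NullMeasurableSpace Ω P) fun t => ?_)
  let L : Ω → ℝ := fun ω => ⨆ n, (σ * W (TopologicalSpace.denseSeq (Iic t) n) ω +
    powerMean c γ (TopologicalSpace.denseSeq (Iic t) n))
  let R : Ω → ℝ := fun ω => ⨆ n, (σ * W (TopologicalSpace.denseSeq (Ici t) n) ω +
    powerMean c γ (TopologicalSpace.denseSeq (Ici t) n))
  have hm := hW.gaussian.aemeasurable
  have hL : AEMeasurable L P := AEMeasurable.iSup fun n => ((hm _).const_mul σ).add_const _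
  have hR : AEMeasurable R P := AEMeasurable.iSup fun n => ((hm _).const_mul σ).add_const _
  refine (nullMeasurableSet_lt hR hL).congr ?_
  filter_upwards [hs, hW.ae_isMaxOn_unique hσ (continuous_powerMean c hγ), hW.continuous_paths,
    hW.ae_tendsto_atBot (γ := γ) hσ hc] with ω hmax huniq hcont hlim
  have hG : Continuous fun t => σ * W t ω + powerMean c γ t :=
    (hcont.const_mul σ).add (continuous_powerMean c hγ)
  have hmax' : ∀ r, σ * W r ω + powerMean c γ r ≤
      σ * W (s_hat ω) ω + powerMean c γ (s_hat ω) := fun r => hmax (mem_univ r)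
  have hmem : ∀ r, (∀ u, σ * W u ω + powerMean c γ u ≤ σ * W r ω + powerMean c γ r) →
      IsMaxOn (fun t => σ * W t ω + powerMean c γ t) univ r := fun r h u _ => h u
  refine propext (show R ω < L ω ↔ s_hat ω < t from ?_)
  constructor
  · intro h
    by_contra! hts
    have hRe : R ω = _ := ciSup_denseSeq_eq (X := Ici t) (hG.comp continuous_subtype_val)
      (x := ⟨s_hat ω, hts⟩) fun y => hmax' y
    exact absurd h (not_lt.2 (hRe ▸ ciSup_le fun n => hmax' _))
  · intro h
    have hLe : L ω = _ := ciSup_denseSeq_eq (X := Iic t) (hG.comp continuous_subtype_val)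
      (x := ⟨s_hat ω, h.le⟩) fun y => hmax' y
    -- by coercivity the supremum over the closed half line is attained
    obtain ⟨r, hr, hrmax⟩ := hG.continuousOn.exists_isMaxOn' isClosed_Ici (self_mem_Ici (a := t))
      ((hlim.eventually (eventually_le_atBot _)).filter_mono inf_le_left)
    have hRe : R ω = _ := ciSup_denseSeq_eq (X := Ici t) (hG.comp continuous_subtype_val)
      (x := ⟨r, hr⟩) fun y => hrmax y.2
    rw [hLe, hRe]
    refine lt_of_le_of_ne (hmax' r) fun heq => ?_
    have : s_hat ω = r := huniq _ _ hmax (hmem r fun u => (hmax' u).trans_eq heq.symm)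
    exact absurd (show t ≤ r from hr) (not_le.2 (this ▸ h))

end IsTwoSidedBrownianMotion

/-- A distribution function jumps at every atom. -/
theorem not_continuousAt_cdf_of_atom {Ω : Type*} [MeasurableSpace Ω] {P : Measure Ω}
    [IsFiniteMeasure P] {X : Ω → ℝ} (hX : AEMeasurable X P) {x : ℝ} (h : 0 < P {ω | X ω = x}) :
    ¬ ContinuousAt (fun t : ℝ => P.real {ω | X ω ≤ t}) x := by
  intro hcont
  have hpos : 0 < P.real {ω | X ω = x} := ENNReal.toReal_pos h.ne' (measure_ne_top _ _)
  have hev := hcont.tendsto.eventually (lt_mem_nhds (sub_lt_self _ hpos))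
  obtain ⟨t, ht, htx⟩ := ((hev.filter_mono nhdsWithin_le_nhds).and
    (self_mem_nhdsWithin (a := x) (s := Iio x))).exists
  have hdisj : Disjoint {ω | X ω ≤ t} {ω | X ω = x} := by
    rw [Set.disjoint_left]
    intro ω (h1 : X ω ≤ t) (h2 : X ω = x)
    have : t < x := htx
    linarith
  have hunion := measureReal_union₀ (μ := P)
    (nullMeasurableSet_eq_fun hX (aemeasurable_const (b := x))) hdisj.aedisjoint
  have hle : P.real ({ω | X ω ≤ t} ∪ {ω | X ω = x}) ≤ P.real {ω | X ω ≤ x} :=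
    measureReal_mono fun ω hω => hω.elim (fun h => h.trans (le_of_lt htx)) fun h => le_of_eq h
  linarith

/-- For small exponents the constant `c` can be chosen so large that the maximizer vanishes with
positive probability. -/
theorem argmax_has_atom {γ σ : ℝ} (hγ : 0 < γ) (hγ2 : γ < 1 / 2) (hσ : 0 < σ) :
    ∃ c : ℝ, 0 < c ∧
      ∀ (Ω : Type*) [MeasurableSpace Ω] (P : Measure Ω) [IsProbabilityMeasure P]
        (W : ℝ → Ω → ℝ), IsTwoSidedBrownianMotion W P →
        (∀ᵐ ω ∂P, ∃! s : ℝ, IsMaxOn (fun t : ℝ => σ * W t ω + powerMean c γ t) univ s) ∧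
        ∀ s_hat : Ω → ℝ,
          (∀ᵐ ω ∂P, IsMaxOn (fun t : ℝ => σ * W t ω + powerMean c γ t) univ (s_hat ω)) →
          AEMeasurable s_hat P ∧
          0 < P {ω | s_hat ω = 0} ∧
          ¬ ContinuousAt (fun t : ℝ => P.real {ω | s_hat ω ≤ t}) 0 := by
  obtain ⟨p, hp⟩ : ∃ p : ℝ, p = (1 / 2 : ℝ) ^ γ := ⟨_, rfl⟩
  have hp2 : 1 / 2 < p ^ 2 := hp ▸ half_lt_half_rpow_sq hγ2
  set K := 4 + 1 / p ^ 2 * (1 - 1 / (2 * p ^ 2))⁻¹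
  have hK0 : 0 < K := by
    have : 1 / (2 * p ^ 2) < 1 := by rw [div_lt_one (by linarith)]; linarith
    have : 0 < (1 - 1 / (2 * p ^ 2))⁻¹ := inv_pos.2 (by linarith)
    positivity
  -- with `c = 2 σ √K` the bound on each half line is `(σ / c) ^ 2 * K = 1 / 4`
  have hc : 0 < 2 * σ * √K := by positivity
  have hsmall : (σ / (2 * σ * √K)) ^ 2 * K < 1 / 2 := by
    have : (σ / (2 * σ * √K)) ^ 2 * K = 1 / 4 := by
      rw [div_pow, mul_pow, Real.sq_sqrt hK0.le]
      field_simp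
      norm_num
    rw [this]; norm_num
  refine ⟨2 * σ * √K, hc, fun Ω _ P _ W hW => ⟨?_, fun s_hat hs => ?_⟩⟩
  · filter_upwards [hW.ae_isMaxOn_unique hσ (continuous_powerMean _ hγ), hW.continuous_paths,
      hW.ae_tendsto_atBot (γ := γ) hσ hc] with ω huniq hcont hlim
    have hG := (hcont.const_mul σ).add (continuous_powerMean (2 * σ * √K) hγ)
    obtain ⟨s, hs⟩ := hG.exists_forall_ge hlim
    exact ⟨s, fun t _ => hs t, fun r hr => huniq r s hr fun t _ => hs t⟩
  · have hmeas := hW.aemeasurable_argmax hσ hc hγ hs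
    have hpos : 0 < P {ω | s_hat ω = 0} := by
      refine (hW.measure_isMaxOn_zero_pos hσ hc hγ hp hp2 hsmall).trans_le (measure_mono_ae ?_)
      filter_upwards [hs, hW.ae_isMaxOn_unique hσ (continuous_powerMean _ hγ)] with ω h1 h2 h3
      exact h2 _ _ h1 h3
    exact ⟨hmeas, hpos, not_continuousAt_cdf_of_atom hmeas hpos⟩

/-! ### Reproducing kernel Hilbert spaces -/

/-- Every feature map `φ` into a Hilbert space exhibits the functions `x ↦ ⟪φ x, v⟫` as elements of
the reproducing kernel Hilbert space of the kernel `⟪φ x, φ y⟫`. That Hilbert space is realized on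
the closed span of the features, on which the evaluations are jointly injective. -/
theorem inner_mem_rkhsOfKernel {X E : Type} [NormedAddCommGroup E] [InnerProductSpace ℝ E]
    [CompleteSpace E] (φ : X → E) (v : E) :
    (fun x => inner ℝ (φ x) v) ∈ rkhsOfKernel (fun x y => inner ℝ (φ x) (φ y)) := by
  let V : Submodule ℝ E := (Submodule.span ℝ (range φ)).topologicalClosure
  have hV : CompleteSpace V := (Submodule.isClosed_topologicalClosure _).completeSpace_coe
  let ψ : X → V := fun x =>
    ⟨φ x, Submodule.le_topologicalClosure _ (Submodule.subset_span (mem_range_self x))⟩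
  let rk : RKHS ℝ V X ℝ :=
    { coeCLM := ContinuousLinearMap.pi fun x => innerSL ℝ (ψ x)
      coeCLM_injective := by
        refine (injective_iff_map_eq_zero _).2 fun h hh => ?_
        have h0 : ∀ x, inner ℝ (φ x) (h : E) = 0 := fun x => congrFun hh x
        have hle : (Submodule.span ℝ (range φ)).topologicalClosure ≤ (ℝ ∙ (h : E))ᗮ := by
          refine Submodule.topologicalClosure_minimal _ (Submodule.span_le.2 ?_)
            (Submodule.isClosed_orthogonal _)
          rintro _ ⟨x, rfl⟩
          rw [SetLike.mem_coe, Submodule.mem_orthogonal_singleton_iff_inner_left]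
          exact h0 x
        have := Submodule.mem_orthogonal_singleton_iff_inner_left.1 (hle h.2)
        exact Subtype.ext (inner_self_eq_zero.1 this) }
  have happ : ∀ (h : V) (x : X), h x = inner ℝ (φ x) (h : E) := fun h x => rfl
  have hker : ∀ x, RKHS.kerFun V x 1 = ψ x := fun x => by
    refine ext_inner_right ℝ fun h => ?_
    rw [RKHS.kerFun_inner, happ]
    simp [ψ]
  refine ⟨V, inferInstance, inferInstance, hV, rk, fun x y => ?_, V.orthogonalProjectionOnto v,
    fun x => ?_⟩
  · have := RKHS.kernel_inner V x y (1 : ℝ) 1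
    rw [hker, hker] at this
    have h1 : inner ℝ (RKHS.kernel V x y 1) (1 : ℝ) = RKHS.kernel V x y 1 := by simp
    rw [← h1, this, real_inner_comm]
    rfl
  · rw [happ]
    exact (V.inner_orthogonalProjectionOnto_eq_of_mem_left (ψ x) v)

/-- Bessel's inequality in a reproducing kernel Hilbert space: squared differences of a member,
weighted by the inverse norms of the corresponding orthogonal differences of kernel functions, are
summable. The differences `K (s i) - K (t i)` of kernel functions are assumed to be orthogonal with
squared norms `w i`. -/
theorem exists_sum_sq_le_of_mem_rkhsOfKernel {X : Type} {K : X → X → ℝ} {f : X → ℝ}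
    (hf : f ∈ rkhsOfKernel K) (s t : ℕ → X) {w : ℕ → ℝ} (hw : ∀ i, 0 < w i)
    (hK : ∀ i j, K (s i) (s j) - K (s i) (t j) - (K (t i) (s j) - K (t i) (t j)) =
      if i = j then w i else 0) :
    ∃ C : ℝ, ∀ n, ∑ i ∈ Finset.range n, (f (s i) - f (t i)) ^ 2 / w i ≤ C := by
  obtain ⟨H, _, _, _, _, hker, h, hh⟩ := hf
  let k : X → H := fun x => RKHS.kerFun H x 1
  have hkk : ∀ x y, inner ℝ (k x) (k y) = K x y := fun x y => by
    rw [← hker, real_inner_comm, ← RKHS.kernel_inner]; simp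
  have hkh : ∀ x, inner ℝ (k x) h = f x := fun x => by
    rw [RKHS.kerFun_inner, hh]; simp
  let e : ℕ → H := fun i => k (s i) - k (t i)
  have hee : ∀ i j, inner ℝ (e i) (e j) = if i = j then w i else 0 := fun i j => by
    rw [← hK i j]
    simp only [e, inner_sub_left, inner_sub_right, hkk]
    ring
  let v : ℕ → H := fun i => (√(w i))⁻¹ • e i
  have hv : Orthonormal ℝ v := by
    rw [orthonormal_iff_ite]
    intro i j
    simp only [v, real_inner_smul_left, real_inner_smul_right, hee]
    split_ifs with hij
    · subst hij
      rw [← mul_assoc, ← mul_inv, Real.mul_self_sqrt (hw i).le, inv_mul_cancel₀ (hw i).ne']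
    · simp
  refine ⟨‖h‖ ^ 2, fun n => (Finset.sum_le_sum fun i _ => le_of_eq ?_).trans
    (hv.sum_inner_products_le h (s := Finset.range n))⟩
  simp only [v, e, real_inner_smul_left, inner_sub_left, hkh, Real.norm_eq_abs, sq_abs]
  rw [mul_pow, inv_pow, Real.sq_sqrt (hw i).le]
  ring

/-! ### The mean function in the Hilbert space of the Brownian kernel -/

/-- Along `t i = 2 ^ (-i)` the kernel functions have orthogonal increments with squared norms of
order `2 ^ (-i)`, whereas the squared increments of `powerMean c γ` are of order `2 ^ (-2 γ i)`. For
`γ ≤ 1 / 2` the quotients stay away from `0`, against Bessel's inequality. -/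
theorem half_lt_of_rkhsCondition {γ σ c : ℝ} (hγ : 0 < γ) (hσ : 0 < σ) (hc : 0 < c)
    (h : RKHSCondition (powerMean c γ) (fun s t => σ ^ 2 * twoSidedBMKernel s t)) :
    1 / 2 < γ := by
  by_contra! hγ2
  have h1 := h 1
  have hmem : ∀ i : ℕ, (1 / 2 : ℝ) ^ i ∈ Icc (-((1 : ℕ) : ℝ)) ((1 : ℕ) : ℝ) := fun i => by
    have h0 : (0 : ℝ) ≤ (1 / 2) ^ i := by positivity
    have h1 : (1 / 2 : ℝ) ^ i ≤ 1 := pow_le_one₀ (by norm_num) (by norm_num)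
    constructor <;> push_cast <;> linarith
  let t : ℕ → Icc (-((1 : ℕ) : ℝ)) ((1 : ℕ) : ℝ) := fun i => ⟨(1 / 2) ^ i, hmem i⟩
  have hker : ∀ i j, twoSidedBMKernel (t i : ℝ) (t j) = (1 / 2) ^ max i j := fun i j => by
    rw [twoSidedBMKernel_of_nonneg (by positivity) (by positivity)]
    have hanti : Antitone fun n : ℕ => (1 / 2 : ℝ) ^ n :=
      pow_right_anti₀ (by norm_num) (by norm_num)
    exact (hanti.map_max (a := i) (b := j)).symm
  obtain ⟨C, hC⟩ := exists_sum_sq_le_of_mem_rkhsOfKernel h1 t (fun i => t (i + 1))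
    (w := fun i => σ ^ 2 * (1 / 2) ^ (i + 1)) (fun i => by positivity) fun i j => by
      simp only [hker]
      rcases lt_trichotomy i j with hij | rfl | hij
      · rw [if_neg hij.ne, max_eq_right hij.le, max_eq_right (by omega), max_eq_right (by omega),
          max_eq_right (by omega)]
        ring
      · rw [if_pos rfl, max_self, max_eq_right (by omega), max_eq_left (by omega), max_self]
        ring
      · rw [if_neg hij.ne', max_eq_left hij.le, max_eq_left (by omega), max_eq_left (by omega),
          max_eq_left (by omega)]
        ring
  obtain ⟨p, hp⟩ : ∃ p : ℝ, p = (1 / 2 : ℝ) ^ γ := ⟨_, rfl⟩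
  have hp0 : 0 < p := hp ▸ by positivity
  have hp1 : p < 1 := hp ▸ Real.rpow_lt_one (by norm_num) (by norm_num) hγ
  have hp2 : 1 / 2 ≤ p ^ 2 := by
    rw [hp, ← Real.rpow_mul_natCast (by norm_num)]
    conv_lhs => rw [← Real.rpow_one (1 / 2 : ℝ)]
    exact Real.rpow_le_rpow_of_exponent_ge (by norm_num) (by norm_num) (by push_cast; linarith)
  have hval : ∀ i, powerMean c γ (t i) = -c * p ^ i := fun i => by
    have h0 : (0 : ℝ) ≤ (1 / 2) ^ i := by positivity
    have h1 : (1 / 2 : ℝ) ^ i ≤ 1 := pow_le_one₀ (by norm_num) (by norm_num)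
    change powerMean c γ ((1 / 2) ^ i) = _
    rw [powerMean_of_le_one hγ (by rwa [abs_of_nonneg h0]), abs_of_nonneg h0, hp,
      ← Real.rpow_mul_natCast (by norm_num), mul_comm γ, Real.rpow_natCast_mul (by norm_num)]
  set η := c ^ 2 * (1 - p) ^ 2 / σ ^ 2 with hη
  have hη0 : 0 < η := by
    have : 0 < 1 - p := by linarith
    positivity
  -- no term of the Bessel sum is smaller than `η`
  have hterm : ∀ i, η ≤ (powerMean c γ (t i) - powerMean c γ (t (i + 1))) ^ 2 /
      (σ ^ 2 * (1 / 2) ^ (i + 1)) := fun i => by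
    rw [hval, hval, le_div_iff₀ (by positivity), hη]
    have e1 : c ^ 2 * (1 - p) ^ 2 / σ ^ 2 * (σ ^ 2 * (1 / 2) ^ (i + 1)) =
        c ^ 2 * (1 - p) ^ 2 * (1 / 2) ^ (i + 1) := by field_simp
    have e2 : (-c * p ^ i - -c * p ^ (i + 1)) ^ 2 = c ^ 2 * (1 - p) ^ 2 * (p ^ 2) ^ i := by ring
    rw [e1, e2]
    refine mul_le_mul_of_nonneg_left ?_ (by positivity)
    calc (1 / 2 : ℝ) ^ (i + 1) ≤ (1 / 2) ^ i :=
          pow_le_pow_of_le_one (by norm_num) (by norm_num) (Nat.le_succ i)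
      _ ≤ (p ^ 2) ^ i := pow_le_pow_left₀ (by norm_num) hp2 i
  obtain ⟨n, hn⟩ := exists_nat_gt (C / η)
  have h2 : (n : ℝ) * η ≤ C := by
    refine le_trans ?_ (hC n)
    rw [← nsmul_eq_mul]
    calc n • η = ∑ i ∈ Finset.range n, η := by simp
      _ ≤ _ := Finset.sum_le_sum fun i _ => hterm i
  rw [div_lt_iff₀ hη0] at hn
  linarith

/-- The even function that equals the derivative of `powerMean c γ` on `(0, ∞)` (except at `1`).
Evenness makes its integrals over both half lines agree with the even function `powerMean c γ`, and
so corresponds to the features in `volume_real_uIoc_inter_uIoc`, which carry no sign. -/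
noncomputable def powerMeanSlope (c γ s : ℝ) : ℝ :=
  if |s| ≤ 1 then -c * (γ * |s| ^ (γ - 1)) else -c

theorem measurable_powerMeanSlope (c γ : ℝ) : Measurable (powerMeanSlope c γ) := by
  refine Measurable.ite (measurableSet_le (by fun_prop) measurable_const) ?_ measurable_const
  fun_prop

/-- The slope is square integrable near `0` because `2 (γ - 1) > -1`. -/
theorem memLp_powerMeanSlope (c : ℝ) {γ : ℝ} (hγ : 1 / 2 < γ) (N : ℕ) :
    MemLp (powerMeanSlope c γ) 2 (volume.restrict (Icc (-(N : ℝ)) N)) := by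
  rw [memLp_two_iff_integrable_sq (measurable_powerMeanSlope c γ).aestronglyMeasurable]
  have h1 : IntervalIntegrable (fun s : ℝ => |s| ^ (2 * γ - 2)) volume (-(N : ℝ)) N := by
    refine intervalIntegrable_of_even (fun x => by rw [abs_neg]) fun x hx => ?_
    refine (intervalIntegral.intervalIntegrable_rpow' (r := 2 * γ - 2) (by linarith)).congr ?_
    intro y hy
    rw [uIoc_of_le hx.le] at hy
    simp only [abs_of_pos hy.1]
  rw [intervalIntegrable_iff_integrableOn_Icc_of_le (by simp)] at h1
  refine ((h1.const_mul (c ^ 2 * γ ^ 2)).add (integrable_const (c ^ 2))).mono'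
    ((measurable_powerMeanSlope c γ).pow_const 2).aestronglyMeasurable (ae_of_all _ fun s => ?_)
  rw [Real.norm_of_nonneg (sq_nonneg _)]
  have h0 : 0 ≤ |s| ^ (2 * γ - 2) := by positivity
  simp only [powerMeanSlope, Pi.add_apply]
  split_ifs
  · have : (|s| ^ (γ - 1)) ^ 2 = |s| ^ (2 * γ - 2) := by
      rw [← Real.rpow_mul_natCast (abs_nonneg s)]; congr 1; push_cast; ring
    rw [mul_pow, mul_pow, this]
    nlinarith [sq_nonneg c]
  · have : 0 ≤ c ^ 2 * γ ^ 2 * |s| ^ (2 * γ - 2) := by positivity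
    nlinarith

theorem hasDerivAt_powerMean {c γ s : ℝ} (hγ : 0 < γ) (hs : 0 < s) (hs1 : s ≠ 1) :
    HasDerivAt (powerMean c γ) (powerMeanSlope c γ s) s := by
  rcases lt_or_gt_of_ne hs1 with h | h
  · rw [powerMeanSlope, if_pos (by rw [abs_of_pos hs]; exact h.le), abs_of_pos hs]
    refine ((Real.hasDerivAt_rpow_const (Or.inl hs.ne')).const_mul (-c)).congr_of_eventuallyEq ?_
    filter_upwards [Ioo_mem_nhds hs h] with x hx
    rw [powerMean_of_le_one hγ (by rw [abs_of_pos hx.1]; exact hx.2.le), abs_of_pos hx.1]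
  · rw [powerMeanSlope, if_neg (by rw [abs_of_pos hs]; exact not_le.2 h)]
    have hd := (hasDerivAt_id s).const_mul (-c)
    rw [mul_one] at hd
    refine hd.congr_of_eventuallyEq ?_
    filter_upwards [Ioi_mem_nhds h] with x hx
    have hx1 : 1 < x := hx
    rw [powerMean_of_one_le (by rw [abs_of_pos (by linarith)]; exact hx1.le),
      abs_of_pos (by linarith)]
    rfl

theorem setIntegral_powerMeanSlope {c γ : ℝ} (hγ : 1 / 2 < γ) {N : ℕ} {t : ℝ}
    (ht : t ∈ Icc (-(N : ℝ)) N) : ∫ s in uIoc 0 t, powerMeanSlope c γ s = powerMean c γ t := by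
  have hint : ∀ {a b : ℝ}, a ∈ Icc (-(N : ℝ)) N → b ∈ Icc (-(N : ℝ)) N →
      IntervalIntegrable (powerMeanSlope c γ) volume a b := fun {a b} ha hb => by
    rw [intervalIntegrable_iff]
    refine IntegrableOn.mono_set ((memLp_powerMeanSlope c hγ N).integrable one_le_two) ?_
    exact uIoc_subset_uIcc.trans (uIcc_subset_Icc ha hb)
  have h0 : (0 : ℝ) ∈ Icc (-(N : ℝ)) N := by simp
  have key : ∀ {u : ℝ}, 0 ≤ u → u ∈ Icc (-(N : ℝ)) N →
      ∫ s in (0 : ℝ)..u, powerMeanSlope c γ s = powerMean c γ u := fun {u} hu huN => by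
    rw [integral_eq_of_hasDerivAt_off_countable_of_le (powerMean c γ) _ hu
      (countable_singleton 1) (continuous_powerMean c (by linarith)).continuousOn
      (fun x hx => hasDerivAt_powerMean (by linarith) hx.1.1 hx.2) (hint h0 huN)]
    simp [powerMean]
  rcases le_total 0 t with h | h
  · rw [uIoc_of_le h, ← intervalIntegral.integral_of_le h, key h ht]
  · rw [uIoc_of_ge h, ← intervalIntegral.integral_of_le h, ← powerMean_neg,
      ← key (u := -t) (by linarith) ⟨by linarith [ht.2], by linarith [ht.1]⟩]
    have heven : ∀ s, powerMeanSlope c γ (-s) = powerMeanSlope c γ s := fun s => by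
      simp [powerMeanSlope]
    have := intervalIntegral.integral_comp_neg (a := t) (b := 0) (powerMeanSlope c γ)
    simpa only [heven, neg_zero] using this

/-- The kernel of the two-sided Brownian motion is the Gram kernel of the indicators of the
intervals between `0` and `t` in `L²`. -/
theorem volume_real_uIoc_inter_uIoc (s t : ℝ) :
    volume.real (uIoc 0 s ∩ uIoc 0 t) = twoSidedBMKernel s t := by
  have hpos : ∀ {s t : ℝ}, 0 ≤ s → 0 ≤ t →
      volume.real (uIoc 0 s ∩ uIoc 0 t) = twoSidedBMKernel s t := fun {s t} hs ht => by
    rw [uIoc_of_le hs, uIoc_of_le ht, Ioc_inter_Ioc, Real.volume_real_Ioc_of_le (by simp [hs, ht]),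
      twoSidedBMKernel_of_nonneg hs ht]
    simp
  have hmix : ∀ {s t : ℝ}, s ≤ 0 → 0 ≤ t →
      volume.real (uIoc 0 s ∩ uIoc 0 t) = twoSidedBMKernel s t := fun {s t} hs ht => by
    rw [uIoc_of_ge hs, uIoc_of_le ht, Ioc_inter_Ioc, twoSidedBMKernel_of_nonpos_of_nonneg hs ht]
    simp [hs, ht]
  rcases le_total 0 s with hs | hs <;> rcases le_total 0 t with ht | ht
  · exact hpos hs ht
  · rw [inter_comm, hmix ht hs, twoSidedBMKernel_comm]
  · exact hmix hs ht
  · rw [uIoc_of_ge hs, uIoc_of_ge ht, Ioc_inter_Ioc,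
      Real.volume_real_Ioc_of_le (by simp [hs, ht]), ← twoSidedBMKernel_neg_neg,
      twoSidedBMKernel_of_nonneg (by linarith) (by linarith), min_neg_neg]
    simp

/-- `powerMean c γ` is the image of its slope under the feature map of the kernel into `L²`. -/
theorem rkhsCondition_of_half_lt {γ σ : ℝ} (c : ℝ) (hσ : 0 < σ) (hγ : 1 / 2 < γ) :
    RKHSCondition (powerMean c γ) (fun s t => σ ^ 2 * twoSidedBMKernel s t) := by
  intro N
  let ν : Measure ℝ := volume.restrict (Icc (-(N : ℝ)) N)
  have hsub : ∀ t : Icc (-(N : ℝ)) (N : ℝ), uIoc 0 (t : ℝ) ⊆ Icc (-(N : ℝ)) N := fun t =>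
    uIoc_subset_uIcc.trans (uIcc_subset_Icc (by simp) t.2)
  let φ : Icc (-(N : ℝ)) (N : ℝ) → Lp ℝ 2 ν := fun t =>
    σ • indicatorConstLp 2 (measurableSet_uIoc (a := 0) (b := (t : ℝ))) (measure_ne_top ν _) 1
  let v : Lp ℝ 2 ν := σ⁻¹ • (memLp_powerMeanSlope c hγ N).toLp
  have h := inner_mem_rkhsOfKernel φ v
  have hK : (fun s t => inner ℝ (φ s) (φ t)) =
      fun s t : Icc (-(N : ℝ)) (N : ℝ) => σ ^ 2 * twoSidedBMKernel s t := by
    ext s t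
    simp only [φ, real_inner_smul_left, real_inner_smul_right]
    rw [L2.real_inner_indicatorConstLp_one_indicatorConstLp_one measurableSet_uIoc
      measurableSet_uIoc, measureReal_restrict_apply (measurableSet_uIoc.inter measurableSet_uIoc),
      inter_eq_left.2 (inter_subset_left.trans (hsub s)), volume_real_uIoc_inter_uIoc]
    ring
  have hf : (fun t => inner ℝ (φ t) v) = fun t : Icc (-(N : ℝ)) (N : ℝ) => powerMean c γ t := by
    ext t
    simp only [φ, v, real_inner_smul_left, real_inner_smul_right]
    rw [L2.inner_indicatorConstLp_one measurableSet_uIoc,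
      integral_congr_ae (ae_restrict_of_ae (memLp_powerMeanSlope c hγ N).coeFn_toLp),
      Measure.restrict_restrict measurableSet_uIoc, inter_eq_left.2 (hsub t),
      setIntegral_powerMeanSlope hγ t.2]
    field_simp
  rwa [hK, hf] at h

theorem rkhsCondition_powerMean_iff {γ σ c : ℝ} (hγ : 0 < γ) (hσ : 0 < σ) (hc : 0 < c) :
    RKHSCondition (powerMean c γ) (fun s t => σ ^ 2 * twoSidedBMKernel s t) ↔ 1 / 2 < γ :=
  ⟨half_lt_of_rkhsCondition hγ hσ hc, rkhsCondition_of_half_lt c hσ⟩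

end

theorem mainTheorem2 :
    (∀ γ σ : ℝ, 0 < γ → γ < 1 / 2 → 0 < σ →
      ∃ c : ℝ, 0 < c ∧
        ∀ (Ω : Type*) [MeasurableSpace Ω] (P : Measure Ω) [IsProbabilityMeasure P]
          (W : ℝ → Ω → ℝ), IsTwoSidedBrownianMotion W P →
          (∀ᵐ ω ∂P, ∃! s : ℝ, IsMaxOn (fun t : ℝ => σ * W t ω + powerMean c γ t) univ s) ∧
          ∀ s_hat : Ω → ℝ,
            (∀ᵐ ω ∂P, IsMaxOn (fun t : ℝ => σ * W t ω + powerMean c γ t) univ (s_hat ω)) →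
            AEMeasurable s_hat P ∧
            0 < P {ω | s_hat ω = 0} ∧
            ¬ ContinuousAt (fun t : ℝ => P.real {ω | s_hat ω ≤ t}) 0) ∧
    (∀ γ σ c : ℝ, 0 < γ → 0 < σ → 0 < c →
      (RKHSCondition (powerMean c γ) (fun s t => σ ^ 2 * twoSidedBMKernel s t) ↔ 1 / 2 < γ)) := by
  exact ⟨fun γ σ hγ hγ2 hσ => argmax_has_atom hγ hγ2 hσ,
    fun γ σ c hγ hσ hc => rkhsCondition_powerMean_iff hγ hσ hc⟩
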